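/- Let $U$ be a finite set and let $\kappa\colon 2^U\to\mathbb N$ be a connectivity function on $U$, that is, $\kappa(\emptyset)=0$, $\kappa(X)=\kappa(U\setminus X)$ and $\kappa(X)+\kappa(Y)\ge\kappa(X\cap Y)+\kappa(X\cup Y)$ for all $X,Y\subseteq U$. A $\kappa$-tangle of order $k\ge 0$ is a family $\mathcal T\subseteq 2^U$ such that (0) $\kappa(X)<k$ for all $X\in\mathcal T$; (1) for all $X\subseteq U$ with $\kappa(X)<k$, $X\in\mathcal T$ or $U\setminus X\in\mathcal T$; (2) $X_1\cap X_2\cap X_3\ne\emptyset$ for all $X_1,X_2,X_3\in\mathcal T$; (3) $\{a\}\notin\mathcal T$ for all $a\in U$. A tangle is understood together with its order, that is, as a pair $(\mathcal T,k)$, and $(\mathcal T,k)$ extends $(\mathcal T',k')$ if $\mathcal T'\subseteq\mathcal T$ and $k'\le k$. For $\ell\ge 0$, a $\kappa$-tangle is $\ell$-maximal if it is maximal, with respect to extension, among all $\kappa$-tangles of order at most $\ell$. If $|U|\ge 2$, then for every $\ell\ge 0$ the number of $\ell$-maximal $\kappa$-tangles is at most $|U|-1$. Consequently, if $U\neq\emptyset$,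 then for every $k\ge 0$ the number of $\kappa$-tangles of order $k$ is at most $|U|$. -/

import Mathlib

/-- A connectivity function on `U`: a symmetric, submodular function `κ : 2^U → ℕ` with
`κ ∅ = 0`. -/
structure ConnectivityFunction (U : Type*) where
  /-- the order `κ X` of the separation `(X, Xᶜ)` -/
  toFun : Set U → ℕ
  map_empty : toFun ∅ = 0
  symmetric : ∀ X : Set U, toFun X = toFun Xᶜ
  submodular : ∀ X Y : Set U, toFun (X ∩ Y) + toFun (X ∪ Y) ≤ toFun X + toFun Y

instance {U : Type*} : CoeFun (ConnectivityFunction U) (fun _ => Set U → ℕ) :=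
  ⟨ConnectivityFunction.toFun⟩

/-- The family `𝒯 ⊆ 2^U` is a `κ`-tangle of order `k`. -/
structure IsTangle {U : Type*} (κ : ConnectivityFunction U) (k : ℕ) (𝒯 : Set (Set U)) :
    Prop where
  order_lt : ∀ X ∈ 𝒯, κ X < k
  mem_or_compl_mem : ∀ X : Set U, κ X < k → X ∈ 𝒯 ∨ Xᶜ ∈ 𝒯
  inter_nonempty : ∀ X₁ ∈ 𝒯, ∀ X₂ ∈ 𝒯, ∀ X₃ ∈ 𝒯, (X₁ ∩ X₂ ∩ X₃).Nonempty
  singleton_notMem : ∀ a : U, {a} ∉ 𝒯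

/-- A `κ`-tangle annotated with its order: a pair `(𝒯, k)` such that `𝒯` is a `κ`-tangle of
order `k`. (The order is part of the data, as the same family can be a tangle of several
orders; these count as distinct tangles.) -/
structure Tangle {U : Type*} (κ : ConnectivityFunction U) where
  /-- the order of the tangle -/
  ord : ℕ
  /-- the family of sets -/
  sets : Set (Set U)
  isTangle : IsTangle κ ord sets

/-- The extension order: `S ≤ T` if the order of `S` is at most that of `T` and the family of
`S` is included in that of `T`, that is, if `S` is a truncation of `T`. -/
instance {U : Type*} (κ : ConnectivityFunction U) : PartialOrder (Tangle κ) where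
  le S T := S.ord ≤ T.ord ∧ S.sets ⊆ T.sets
  le_refl S := ⟨le_rfl, subset_rfl⟩
  le_trans _ _ _ h h' := ⟨h.1.trans h'.1, h.2.trans h'.2⟩
  le_antisymm := by
    rintro ⟨k, S, hS⟩ ⟨l, T, hT⟩ ⟨h₁, h₂⟩ ⟨h₃, h₄⟩
    obtain rfl : k = l := le_antisymm h₁ h₃
    obtain rfl : S = T := Set.Subset.antisymm h₂ h₄
    rfl

/-- A `κ`-tangle is `l`-maximal if it is inclusion-wise maximal among all `κ`-tangles of order
at most `l`. -/
def Tangle.IsMaximalUpTo {U : Type*} {κ : ConnectivityFunction U} (l : ℕ) (T : Tangle κ) :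
    Prop :=
  Maximal (fun S : Tangle κ => S.ord ≤ l) T

/-! Distinct `l`-maximal tangles are pairwise distinguished, so it suffices to show that `m ≥ 2`
pairwise distinguished tangles satisfy `m + 2 ≤ |U|`. Induct on `|U|`, splitting along a
distinguishing set `X` of minimum order. Every tangle contains `X` or `Xᶜ`. By uncrossing, those
containing `X` are pairwise distinguished by subsets of `X`, hence stay so when `Xᶜ` is collapsed to
a point. This leaves `|X| + 1 < |U|` points, so at most `|X| - 1` tangles contain `X`; adding the
same bound for `Xᶜ` gives `m ≤ |U| - 2`. -/

/-- The connectivity function induced along a map: the order of a set is the order of its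
preimage. -/
def ConnectivityFunction.map {U V : Type*} (κ : ConnectivityFunction U) (f : U → V) :
    ConnectivityFunction V where
  toFun Z := κ (f ⁻¹' Z)
  map_empty := κ.map_empty
  symmetric Z := κ.symmetric (f ⁻¹' Z)
  submodular Y Z := κ.submodular (f ⁻¹' Y) (f ⁻¹' Z)

/-- The tangle induced along a map none of whose fibres belongs to the tangle. -/
def Tangle.map {U V : Type*} {κ : ConnectivityFunction U} (T : Tangle κ) (f : U → V)
    (hf : ∀ v, f ⁻¹' {v} ∉ T.sets) : Tangle (κ.map f) where
  ord := T.ord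
  sets := {Z | f ⁻¹' Z ∈ T.sets}
  isTangle :=
    { order_lt := fun Z hZ => T.isTangle.order_lt _ hZ
      mem_or_compl_mem := fun Z hZ => T.isTangle.mem_or_compl_mem (f ⁻¹' Z) hZ
      inter_nonempty := fun X hX Y hY Z hZ => by
        obtain ⟨u, hu⟩ := T.isTangle.inter_nonempty _ hX _ hY _ hZ
        exact ⟨f u, hu⟩
      singleton_notMem := hf }

namespace Tangle

variable {U : Type*} {κ : ConnectivityFunction U}

theorem notMem_of_inter_eq_empty (T : Tangle κ) {X Y Z : Set U} (hX : X ∈ T.sets)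
    (hY : Y ∈ T.sets) (h : X ∩ Y ∩ Z = ∅) : Z ∉ T.sets := fun hZ =>
  (T.isTangle.inter_nonempty X hX Y hY Z hZ).ne_empty h

theorem compl_notMem (T : Tangle κ) {X : Set U} (hX : X ∈ T.sets) : Xᶜ ∉ T.sets :=
  T.notMem_of_inter_eq_empty hX hX (by simp)

theorem mem_of_inter_subset (T : Tangle κ) {X Y Z : Set U} (hX : X ∈ T.sets)
    (hY : Y ∈ T.sets) (h : X ∩ Y ⊆ Z) (hZ : κ Z < T.ord) : Z ∈ T.sets :=
  (T.isTangle.mem_or_compl_mem Z hZ).resolve_right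
    (T.notMem_of_inter_eq_empty hX hY (Set.disjoint_compl_right_iff_subset.2 h).inter_eq)

theorem mem_of_subset (T : Tangle κ) {X Z : Set U} (hX : X ∈ T.sets)
    (h : X ⊆ Z) (hZ : κ Z < T.ord) : Z ∈ T.sets :=
  T.mem_of_inter_subset hX hX (Set.inter_subset_left.trans h) hZ

theorem two_le_ncard [Finite U] (T : Tangle κ) {X : Set U} (hX : X ∈ T.sets) :
    2 ≤ X.ncard := by
  have hne : X.Nonempty := by simpa using T.isTangle.inter_nonempty X hX X hX X hX
  have h0 : 0 < X.ncard := (Set.ncard_pos X.toFinite).2 hne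
  have h1 : X.ncard ≠ 1 := fun h => by
    obtain ⟨a, rfl⟩ := Set.ncard_eq_one.1 h
    exact T.isTangle.singleton_notMem a hX
  omega

/-- Two tangles are distinguished by some set if one contains the set and the other one its
complement. -/
def Distinguished (S T : Tangle κ) : Prop := ∃ X, X ∈ S.sets ∧ Xᶜ ∈ T.sets

theorem Distinguished.symm {S T : Tangle κ} (h : Distinguished S T) : Distinguished T S := by
  obtain ⟨X, hS, hT⟩ := h
  exact ⟨Xᶜ, hT, by rwa [compl_compl]⟩

theorem sets_subset_or_distinguished {S T : Tangle κ} (h : S.ord ≤ T.ord) :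
    S.sets ⊆ T.sets ∨ Distinguished S T := by
  by_contra! hc
  obtain ⟨X, hX, hXT⟩ := Set.not_subset.1 hc.1
  exact hc.2 ⟨X, hX, (T.isTangle.mem_or_compl_mem X
    ((S.isTangle.order_lt X hX).trans_le h)).resolve_left hXT⟩

theorem distinguished_of_isMaximalUpTo {l : ℕ} {S T : Tangle κ} (hS : S.IsMaximalUpTo l)
    (hT : T.IsMaximalUpTo l) (hne : S ≠ T) : Distinguished S T := by
  rcases le_total S.ord T.ord with h | h
  · exact (sets_subset_or_distinguished h).resolve_left fun hs =>
      hne (hS.eq_of_le hT.prop ⟨h, hs⟩)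
  · exact ((sets_subset_or_distinguished h).resolve_left fun hs =>
      hne (hT.eq_of_le hS.prop ⟨h, hs⟩).symm).symm

/-- Reduces counting the tangles of a fixed order `k` to counting `k`-maximal ones. -/
theorem isMaximalUpTo_ord (T : Tangle κ) : T.IsMaximalUpTo T.ord := by
  refine ⟨le_rfl, fun S hS hTS => ⟨hS, fun X hX => ?_⟩⟩
  exact (T.isTangle.mem_or_compl_mem X ((S.isTangle.order_lt X hX).trans_le hS)).resolve_right
    fun h => S.compl_notMem hX (hTS.2 h)

/-- Uncrossing: if `X` has minimum order among the sets distinguishing `R` from `S`, then any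
two tangles distinguished by some set, and both containing `X`, are distinguished by a subset
of `X`, up to exchanging the tangles. -/
theorem exists_subset_distinguishing {R S T : Tangle κ} {X : Set U}
    (hXR : Xᶜ ∈ R.sets) (hXS : X ∈ S.sets) (hXT : X ∈ T.sets)
    (hmin : ∀ Y, Y ∈ S.sets → Yᶜ ∈ R.sets → κ X ≤ κ Y) (hST : Distinguished S T) :
    ∃ Y ⊆ X, (Y ∈ S.sets ∧ Yᶜ ∈ T.sets) ∨ (Y ∈ T.sets ∧ Yᶜ ∈ S.sets) := by
  obtain ⟨Y, hYS, hYT⟩ := hST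
  have hoS := S.isTangle.order_lt Y hYS
  have hoT := T.isTangle.order_lt _ hYT
  have hRX := R.isTangle.order_lt _ hXR
  have hSX := S.isTangle.order_lt _ hXS
  have hYc := κ.symmetric Y
  have hXc := κ.symmetric X
  by_cases h₁ : κ (X ∩ Y) ≤ κ Y
  · have hc := κ.symmetric (X ∩ Y)
    exact ⟨X ∩ Y, Set.inter_subset_left, Or.inl
      ⟨S.mem_of_inter_subset hXS hYS subset_rfl (by omega),
      T.mem_of_subset hYT (Set.compl_subset_compl.2 Set.inter_subset_right) (by omega)⟩⟩
  by_cases h₂ : κ (X ∩ Yᶜ) ≤ κ Y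
  · have hc := κ.symmetric (X ∩ Yᶜ)
    exact ⟨X ∩ Yᶜ, Set.inter_subset_left, Or.inr
      ⟨T.mem_of_inter_subset hXT hYT subset_rfl (by omega),
      S.mem_of_subset hYS (fun u hu h => h.2 hu) (by omega)⟩⟩
  -- Both corners inside `X` now have order above `κ Y`, so by submodularity `X ∪ Y` and `X ∪ Yᶜ`
  -- have order below `κ X`. They lie in `S` as supersets of `X`; minimality of `X` forces them into
  -- `R`, where together with `Xᶜ` they intersect in `∅`.
  have key : ∀ Z, X ⊆ Z → κ Z < κ X → Z ∈ R.sets := fun Z hZ hlt =>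
    (R.isTangle.mem_or_compl_mem Z (by omega)).resolve_right fun h =>
      hlt.not_ge (hmin Z (S.mem_of_subset hXS hZ (by omega)) h)
  have s₁ := κ.submodular X Y
  have s₂ := κ.submodular X Yᶜ
  refine absurd hXR (R.notMem_of_inter_eq_empty
    (key (X ∪ Y) Set.subset_union_left (by omega))
    (key (X ∪ Yᶜ) Set.subset_union_left (by omega)) ?_)
  ext u
  simp only [Set.mem_inter_iff, Set.mem_union, Set.mem_compl_iff, Set.mem_empty_iff_false]
  tauto

end Tangle

open Classical in
/-- The map collapsing the complement of `X` to a single point. -/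
noncomputable def collapseCompl {U : Type*} (X : Set U) (u : U) : Option X :=
  if h : u ∈ X then some ⟨u, h⟩ else none

theorem collapseCompl_preimage_none {U : Type*} (X : Set U) :
    collapseCompl X ⁻¹' {none} = Xᶜ := by
  ext u
  by_cases h : u ∈ X <;> simp [collapseCompl, h]

theorem collapseCompl_preimage_some {U : Type*} (X : Set U) (x : X) :
    collapseCompl X ⁻¹' {some x} = {(x : U)} := by
  ext u
  by_cases h : u ∈ X
  · simp [collapseCompl, h, Subtype.ext_iff]
  · have : u ≠ x := fun e => h (e ▸ x.2)
    simp [collapseCompl, h, this]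

theorem exists_collapseCompl_preimage_eq {U : Type*} {X Y : Set U} (h : Y ⊆ X) :
    ∃ Z, collapseCompl X ⁻¹' Z = Y := by
  refine ⟨some '' {x : X | (x : U) ∈ Y}, ?_⟩
  ext u
  by_cases hu : u ∈ X
  · simp [collapseCompl, hu]
  · have : u ∉ Y := fun e => hu (h e)
    simp [collapseCompl, hu, this]

namespace Tangle

/-- The tangle induced on the ground set in which the complement of a member is collapsed. -/
noncomputable def collapse {U : Type*} {κ : ConnectivityFunction U} (T : Tangle κ) {X : Set U}
    (hX : X ∈ T.sets) : Tangle (κ.map (collapseCompl X)) :=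
  T.map (collapseCompl X) fun v => by
    cases v with
    | none => rw [collapseCompl_preimage_none]; exact T.compl_notMem hX
    | some x => rw [collapseCompl_preimage_some]; exact T.isTangle.singleton_notMem x

theorem distinguished_collapse {U : Type*} {κ : ConnectivityFunction U} {S T : Tangle κ}
    {X Y : Set U} (hXS : X ∈ S.sets) (hXT : X ∈ T.sets) (hY : Y ⊆ X) (hYS : Y ∈ S.sets)
    (hYT : Yᶜ ∈ T.sets) : Distinguished (S.collapse hXS) (T.collapse hXT) := by
  obtain ⟨Z, rfl⟩ := exists_collapseCompl_preimage_eq hY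
  exact ⟨Z, hYS, hYT⟩

/-- At least two pairwise distinguished tangles are fewer by two than the points of the ground
set. -/
theorem card_add_two_le_of_pairwise_distinguished {U : Type*} [Finite U]
    {κ : ConnectivityFunction U} {ι : Type*} [Finite ι] (T : ι → Tangle κ)
    (hT : Pairwise fun i j => Distinguished (T i) (T j)) (hι : 2 ≤ Nat.card ι) :
    Nat.card ι + 2 ≤ Nat.card U := by
  induction hn : Nat.card U using Nat.strong_induction_on generalizing U ι with
  | _ n ih =>
  subst hn
  have hside : ∀ X : Set U,
      (∀ i j Y, Y ∈ (T i).sets → Yᶜ ∈ (T j).sets → κ X ≤ κ Y) →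
      (∃ i, X ∈ (T i).sets) → (∃ j, Xᶜ ∈ (T j).sets) →
      Nat.card {i // X ∈ (T i).sets} + 1 ≤ X.ncard := by
    rintro X hmin ⟨i, hi⟩ ⟨j, hj⟩
    have h₁ := (T i).two_le_ncard hi
    have h₂ := (T j).two_le_ncard hj
    have h₃ := Set.ncard_add_ncard_compl X
    by_cases hc : 2 ≤ Nat.card {i // X ∈ (T i).sets}
    · have hcard : Nat.card (Option X) = X.ncard + 1 := by
        rw [Finite.card_option, Nat.card_coe_set_eq]
      have := ih (Nat.card (Option X)) (by omega)
        (fun i : {i // X ∈ (T i).sets} => (T i).collapse i.2) ?_ hc rfl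
      · omega
      · rintro ⟨a, ha⟩ ⟨b, hb⟩ hab
        obtain ⟨Y, hYX, h | h⟩ := exists_subset_distinguishing hj ha hb (hmin a j)
          (hT (fun e => hab (Subtype.ext e)))
        · exact distinguished_collapse ha hb hYX h.1 h.2
        · exact (distinguished_collapse hb ha hYX h.1 h.2).symm
    -- With at most one tangle on this side, `2 ≤ |X|` is enough.
    · omega
  have : Nontrivial ι := Finite.one_lt_card_iff_nontrivial.1 hι
  let D : Set (Set U) := {X | ∃ i j, X ∈ (T i).sets ∧ Xᶜ ∈ (T j).sets}
  have hD : D.Nonempty := by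
    obtain ⟨i, j, hij⟩ := exists_pair_ne ι
    obtain ⟨X, hX⟩ := hT hij
    exact ⟨X, i, j, hX⟩
  obtain ⟨X, ⟨i, j, hi, hj⟩, hX⟩ := Set.exists_min_image D κ D.toFinite hD
  have hmin : ∀ i j Y, Y ∈ (T i).sets → Yᶜ ∈ (T j).sets → κ X ≤ κ Y :=
    fun i j Y h h' => hX Y ⟨i, j, h, h'⟩
  have hA := hside X hmin ⟨i, hi⟩ ⟨j, hj⟩
  have hB := hside Xᶜ (by rwa [← κ.symmetric X]) ⟨j, hj⟩ ⟨i, by rwa [compl_compl]⟩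
  have hU := Set.ncard_add_ncard_compl X
  -- By minimality, `κ X` is below the order of every tangle in the family, since each one is
  -- distinguished from another.
  have hcover : ∀ a, X ∈ (T a).sets ∨ Xᶜ ∈ (T a).sets := by
    intro a
    by_cases hai : a = i
    · exact Or.inl (hai ▸ hi)
    · obtain ⟨Y, hY, hY'⟩ := hT hai
      exact (T a).isTangle.mem_or_compl_mem X
        ((hmin a i Y hY hY').trans_lt ((T a).isTangle.order_lt Y hY))
  have hsum : Nat.card ι ≤
      Nat.card {i // X ∈ (T i).sets} + Nat.card {i // Xᶜ ∈ (T i).sets} := by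
    have h := Set.ncard_union_le {i | X ∈ (T i).sets} {i | Xᶜ ∈ (T i).sets}
    rwa [show {i | X ∈ (T i).sets} ∪ {i | Xᶜ ∈ (T i).sets} = Set.univ from
      Set.eq_univ_of_forall hcover, Set.ncard_univ] at h
  omega

/-- The number of pairwise distinguished tangles is at most any positive `c` that is at least the
size of the ground set minus two. -/
theorem encard_le_of_pairwise_distinguished {U : Type*} [Finite U] {κ : ConnectivityFunction U}
    {F : Set (Tangle κ)} (hF : F.Pairwise Distinguished) {c : ℕ} (hc : 1 ≤ c)
    (hU : Nat.card U ≤ c + 2) : F.encard ≤ c := by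
  by_contra! h
  -- A subfamily of size `c + 1 ≥ 2` would force `c + 3 ≤ |U|`.
  obtain ⟨G, hGF, hG⟩ := Set.exists_subset_encard_eq (Order.add_one_le_of_lt h)
  have hfin : G.Finite := Set.finite_of_encard_eq_coe (k := c + 1) (by exact_mod_cast hG)
  have : Finite G := hfin
  have hcard : Nat.card G = c + 1 := by
    rw [Nat.card_coe_set_eq, Set.ncard, hG]
    rfl
  have := card_add_two_le_of_pairwise_distinguished (fun S : G => (S : Tangle κ))
    (fun S S' hne => hF (hGF S.2) (hGF S'.2) (fun e => hne (Subtype.ext e))) (by omega)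
  omega

end Tangle

theorem mainTheorem6 {U : Type*} [Fintype U] (κ : ConnectivityFunction U) :
    (2 ≤ Fintype.card U →
      ∀ l : ℕ, {T : Tangle κ | T.IsMaximalUpTo l}.encard ≤ ((Fintype.card U - 1 : ℕ) : ℕ∞)) ∧
    (1 ≤ Fintype.card U →
      ∀ k : ℕ, {T : Tangle κ | T.ord = k}.encard ≤ (Fintype.card U : ℕ∞)) := by
  refine ⟨fun hU l => ?_, fun hU k => ?_⟩
  · exact Tangle.encard_le_of_pairwise_distinguished
      (fun S hS T hT hne => Tangle.distinguished_of_isMaximalUpTo hS hT hne)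
      (by omega) (by rw [Nat.card_eq_fintype_card]; omega)
  · refine Tangle.encard_le_of_pairwise_distinguished (fun S hS T hT hne => ?_) hU
      (by rw [Nat.card_eq_fintype_card]; omega)
    have hS' : S.ord = k := hS
    have hT' : T.ord = k := hT
    exact Tangle.distinguished_of_isMaximalUpTo (hS' ▸ S.isMaximalUpTo_ord)
      (hT' ▸ T.isMaximalUpTo_ord) hne
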